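/- **Proposition (Real version of Stone's Theorem).** Let $\mathcal H$ be a real Hilbert space and let $\gamma\colon \mathbb R\to \mathrm O(\mathcal H)$ be a strongly continuous one-parameter group of surjective linear isometries of $\mathcal H$, i.e. $\gamma$ is a group homomorphism and $t\mapsto\gamma(t)v$ is continuous for every $v\in\mathcal H$. Let $\gamma'(0)$ denote its infinitesimal generator, the unbounded operator whose domain consists of all $v\in\mathcal H$ for which $t\mapsto\gamma(t)v$ is differentiable at $0$, with $\gamma'(0)v=\frac{d}{dt}\big|_{t=0}\gamma(t)v$. Let $\mathcal D\subseteq\mathcal H$ be a dense linear subspace such that $\gamma(t)\mathcal D\subseteq\mathcal D$ for all $t\in\mathbb R$ and such that every $v\in\mathcal D$ is a $C^1$-vector, i.e. $t\mapsto\gamma(t)v$ is continuously differentiable on $\mathbb R$. Then the operator $A\colon\mathcal D\to\mathcal H$, $Av:=\gamma'(0)v$, with domain $\mathcal D$, is closable, and its closure $\overline A$ and its adjoint $A^\top$ satisfy $$\overline A=\gamma'(0)=-A^\top$$ as equalities of unbounded operators, including equality of domains. -/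

import Mathlib

noncomputable section

namespace RealStone

variable {H : Type*} [NormedAddCommGroup H] [InnerProductSpace ℝ H]

/-- A one-parameter group `γ : ℝ → O(H)` is a homomorphism from the additive group `ℝ` into the
group `H ≃ₗᵢ[ℝ] H` of surjective linear isometries of `H`. -/
abbrev OneParameterGroup (H : Type*) [NormedAddCommGroup H] [InnerProductSpace ℝ H] : Type _ :=
  Multiplicative ℝ →* (H ≃ₗᵢ[ℝ] H)

/-- The orbit map `t ↦ γ(t) v`. -/
def orbit (γ : OneParameterGroup H) (v : H) (t : ℝ) : H :=
  γ (Multiplicative.ofAdd t) v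

/-- Strong continuity: every orbit map is continuous on `ℝ`. -/
def IsStronglyContinuous (γ : OneParameterGroup H) : Prop :=
  ∀ v : H, Continuous (orbit γ v)

/-- `v` is a `C¹`-vector for `γ` if its orbit map is continuously differentiable on `ℝ`. -/
def IsC1Vector (γ : OneParameterGroup H) (v : H) : Prop :=
  ContDiff ℝ 1 (orbit γ v)

theorem orbit_add (γ : OneParameterGroup H) (v w : H) :
    orbit γ (v + w) = orbit γ v + orbit γ w := by
  funext t
  simp [orbit]

theorem orbit_smul (γ : OneParameterGroup H) (c : ℝ) (v : H) :
    orbit γ (c • v) = c • orbit γ v := by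
  funext t
  simp [orbit]

theorem orbit_zero (γ : OneParameterGroup H) : orbit γ 0 = fun _ => 0 := by
  funext t
  simp [orbit]

/-- The infinitesimal generator `γ'(0)`: its domain consists of all `v` whose orbit map is
differentiable at `0`, and its value at such a `v` is the derivative of the orbit map at `0`. -/
def generator (γ : OneParameterGroup H) : H →ₗ.[ℝ] H where
  domain :=
    { carrier := {v | DifferentiableAt ℝ (orbit γ v) 0}
      add_mem' := by
        intro v w hv hw
        change DifferentiableAt ℝ (orbit γ (v + w)) 0
        rw [orbit_add]
        exact DifferentiableAt.add hv hw
      zero_mem' := by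
        change DifferentiableAt ℝ (orbit γ 0) 0
        rw [orbit_zero]
        exact differentiableAt_const 0
      smul_mem' := by
        intro c v hv
        change DifferentiableAt ℝ (orbit γ (c • v)) 0
        rw [orbit_smul]
        exact DifferentiableAt.const_smul hv c }
  toFun :=
    { toFun := fun v => deriv (orbit γ (v : H)) 0
      map_add' := by
        intro v w
        have hv : DifferentiableAt ℝ (orbit γ (v : H)) 0 := v.2
        have hw : DifferentiableAt ℝ (orbit γ (w : H)) 0 := w.2
        rw [Submodule.coe_add, orbit_add]
        exact deriv_add hv hw
      map_smul' := by
        intro c v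
        have hv : DifferentiableAt ℝ (orbit γ (v : H)) 0 := v.2
        rw [Submodule.coe_smul, orbit_smul]
        exact deriv_const_smul c hv }

theorem IsC1Vector.mem_domain_generator {γ : OneParameterGroup H} {v : H} (hv : IsC1Vector γ v) :
    v ∈ (generator γ).domain :=
  (ContDiff.differentiable hv one_ne_zero) 0

/-- For a subspace `D` of `C¹`-vectors, the operator `A : D → H`, `A v = γ'(0) v`, with domain
exactly `D`. -/
def generatorOn (γ : OneParameterGroup H) (D : Submodule ℝ H) (hD : ∀ v ∈ D, IsC1Vector γ v) :
    H →ₗ.[ℝ] H where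
  domain := D
  toFun := (generator γ).toFun ∘ₗ
    Submodule.inclusion (fun v hv => (hD v hv).mem_domain_generator)

end RealStone

end

namespace RealStone

open scoped RealInnerProductSpace

variable {H : Type*} [NormedAddCommGroup H] [InnerProductSpace ℝ H]

/-! Write B for the generator and A for its restriction to D. Everything rests on a weak description
of B (`mem_graph_generator_iff_inner`): Bw = u iff ⟪u, v⟫ = -⟪w, Av⟫ for all v in D. Skew-symmetry
gives one direction; for the other, moving γ(t) onto v ∈ D and integrating gives γ(t)w = w + ∫₀ᵗ
γ(s)u ds. Hence B is closed and equals minus the adjoint of A. If (x, Bx) is orthogonal to the graph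
of A, then B(Bx) = x, so ‖Bx‖² = -‖x‖² and x = 0; thus A has closure B. -/

theorem orbit_apply_zero (γ : OneParameterGroup H) (v : H) : orbit γ v 0 = v := by
  simp [orbit]

theorem orbit_time_add (γ : OneParameterGroup H) (v : H) (s t : ℝ) :
    orbit γ v (s + t) = γ (Multiplicative.ofAdd s) (orbit γ v t) := by
  simp [orbit, ofAdd_add]

theorem inner_orbit_left (γ : OneParameterGroup H) (v w : H) (t : ℝ) :
    ⟪orbit γ v t, w⟫ = ⟪v, orbit γ w (-t)⟫ := by
  have h : orbit γ (orbit γ w (-t)) t = w := by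
    have := orbit_time_add γ w t (-t)
    rw [add_neg_cancel, orbit_apply_zero] at this
    exact this.symm
  conv_lhs => rw [← h]
  exact (γ (Multiplicative.ofAdd t)).inner_map_map _ _

theorem hasDerivAt_orbit_zero (γ : OneParameterGroup H) (v : (generator γ).domain) :
    HasDerivAt (orbit γ (v : H)) (generator γ v) 0 :=
  DifferentiableAt.hasDerivAt v.2

theorem mem_graph_generator_iff_hasDerivAt (γ : OneParameterGroup H) (w u : H) :
    (w, u) ∈ (generator γ).graph ↔ HasDerivAt (orbit γ w) u 0 := by
  rw [LinearPMap.mem_graph_iff]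
  constructor
  · rintro ⟨y, rfl, rfl⟩
    exact hasDerivAt_orbit_zero γ y
  · exact fun h => ⟨⟨w, h.differentiableAt⟩, rfl, h.deriv⟩

/-- The generator is skew-symmetric. -/
theorem inner_generator_left (γ : OneParameterGroup H) (v w : (generator γ).domain) :
    ⟪generator γ v, (w : H)⟫ = -⟪(v : H), generator γ w⟫ := by
  have h := (hasDerivAt_orbit_zero γ v).inner ℝ (hasDerivAt_orbit_zero γ w)
  have hconst : (fun t => ⟪orbit γ (v : H) t, orbit γ (w : H) t⟫) = fun _ => ⟪(v : H), (w : H)⟫ :=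
    funext fun t => (γ (Multiplicative.ofAdd t)).inner_map_map _ _
  rw [hconst] at h
  have := h.unique (hasDerivAt_const _ _)
  simp only [orbit_apply_zero] at this
  linarith

theorem generatorOn_apply (γ : OneParameterGroup H) {D : Submodule ℝ H}
    (hC1 : ∀ v ∈ D, IsC1Vector γ v) (v : D) :
    generatorOn γ D hC1 v = generator γ ⟨v, (hC1 v v.2).mem_domain_generator⟩ :=
  rfl

theorem generatorOn_le_generator (γ : OneParameterGroup H) {D : Submodule ℝ H}
    (hC1 : ∀ v ∈ D, IsC1Vector γ v) : generatorOn γ D hC1 ≤ generator γ :=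
  ⟨fun v hv => (hC1 v hv).mem_domain_generator, fun x _ hxy =>
    (generatorOn_apply γ hC1 x).trans (congrArg _ (Subtype.ext hxy))⟩

/-- On an invariant space of `C¹`-vectors, orbits solve the Cauchy problem of the generator. -/
theorem hasDerivAt_orbit (γ : OneParameterGroup H) {D : Submodule ℝ H}
    (hinv : ∀ t : ℝ, ∀ v ∈ D, γ (Multiplicative.ofAdd t) v ∈ D)
    (hC1 : ∀ v ∈ D, IsC1Vector γ v) (v : D) (t : ℝ) :
    HasDerivAt (orbit γ (v : H)) (generatorOn γ D hC1 ⟨orbit γ (v : H) t, hinv t v v.2⟩) t := by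
  have h := hasDerivAt_orbit_zero γ
    ⟨orbit γ (v : H) t, (hC1 _ (hinv t v v.2)).mem_domain_generator⟩
  -- By the group law γ(s)v = γ(s - t)γ(t)v, so the derivative at t is that of the orbit of γ(t)v at
  -- 0.
  rw [← sub_self t] at h
  have h' := h.comp_sub_const t t
  refine h'.congr_of_eventuallyEq (Filter.Eventually.of_forall fun s => ?_)
  have := orbit_time_add γ v (s - t) t
  rwa [sub_add_cancel] at this

/-- A weak derivative of an orbit, tested against a dense invariant space of `C¹`-vectors, is a
strong derivative. -/
theorem hasDerivAt_orbit_of_inner_eq [CompleteSpace H] (γ : OneParameterGroup H)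
    (hγ : IsStronglyContinuous γ) {D : Submodule ℝ H} (hdense : Dense (D : Set H))
    (hinv : ∀ t : ℝ, ∀ v ∈ D, γ (Multiplicative.ofAdd t) v ∈ D)
    (hC1 : ∀ v ∈ D, IsC1Vector γ v) {w u : H}
    (h : ∀ v : D, ⟪u, (v : H)⟫ = -⟪w, generatorOn γ D hC1 v⟫) :
    HasDerivAt (orbit γ w) u 0 := by
  have hint (t : ℝ) : HasDerivAt (fun t => ∫ s in (0 : ℝ)..t, orbit γ u s) (orbit γ u t) t :=
    (hγ u).integral_hasStrictDerivAt 0 t |>.hasDerivAt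
  have key : orbit γ w = fun t => w + ∫ s in (0 : ℝ)..t, orbit γ u s := by
    funext t
    refine hdense.eq_of_inner_left ℝ fun v hv => ?_
    have hderiv (s : ℝ) : HasDerivAt
        (fun s => ⟪orbit γ w s, v⟫ - ⟪w + ∫ r in (0 : ℝ)..s, orbit γ u r, v⟫) 0 s := by
      -- Since γ(-s)v stays in D, `h` applies to it: the derivative of ⟪w, γ(-s)v⟫ is -⟪w, Aγ(-s)v⟫
      -- = ⟪u, γ(-s)v⟫.
      have h1 : HasDerivAt (fun s => ⟪orbit γ w s, v⟫) ⟪orbit γ u s, v⟫ s := by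
        simp only [inner_orbit_left]
        have hneg := (hasDerivAt_orbit γ hinv hC1 ⟨v, hv⟩ (-s)).scomp s (hasDerivAt_neg s)
        have := (hasDerivAt_const s w).inner ℝ hneg
        simp only [inner_zero_left, add_zero, neg_smul, one_smul, inner_neg_right] at this
        rw [h ⟨orbit γ v (-s), hinv (-s) v hv⟩]
        exact this
      have h2 := ((hint s).const_add w).inner ℝ (hasDerivAt_const s v)
      convert! h1.sub h2 using 1
      simp
    have := is_const_of_deriv_eq_zero (fun s => (hderiv s).differentiableAt)
      (fun s => (hderiv s).deriv) t 0
    simpa [orbit_apply_zero, sub_eq_zero] using this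
  rw [key]
  simpa [orbit_apply_zero] using (hint 0).const_add w

/-- These equations are closed conditions on (w, u), and they are also the defining equations of
minus the adjoint of A. -/
theorem mem_graph_generator_iff_inner [CompleteSpace H] (γ : OneParameterGroup H)
    (hγ : IsStronglyContinuous γ) {D : Submodule ℝ H} (hdense : Dense (D : Set H))
    (hinv : ∀ t : ℝ, ∀ v ∈ D, γ (Multiplicative.ofAdd t) v ∈ D)
    (hC1 : ∀ v ∈ D, IsC1Vector γ v) (w u : H) :
    (w, u) ∈ (generator γ).graph ↔
      ∀ v : D, ⟪u, (v : H)⟫ = -⟪w, generatorOn γ D hC1 v⟫ := by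
  constructor
  · intro h v
    obtain ⟨y, rfl, rfl⟩ := (LinearPMap.mem_graph_iff _).1 h
    exact inner_generator_left γ y ⟨v, (hC1 v v.2).mem_domain_generator⟩
  · exact fun h => (mem_graph_generator_iff_hasDerivAt γ w u).2
      (hasDerivAt_orbit_of_inner_eq γ hγ hdense hinv hC1 h)

theorem generator_isClosed [CompleteSpace H] (γ : OneParameterGroup H)
    (hγ : IsStronglyContinuous γ) {D : Submodule ℝ H} (hdense : Dense (D : Set H))
    (hinv : ∀ t : ℝ, ∀ v ∈ D, γ (Multiplicative.ofAdd t) v ∈ D)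
    (hC1 : ∀ v ∈ D, IsC1Vector γ v) : (generator γ).IsClosed := by
  have : ((generator γ).graph : Set (H × H)) =
      ⋂ v : D, {p : H × H | ⟪p.2, (v : H)⟫ = -⟪p.1, generatorOn γ D hC1 v⟫} := by
    ext ⟨w, u⟩
    simpa using mem_graph_generator_iff_inner γ hγ hdense hinv hC1 w u
  rw [LinearPMap.IsClosed, this]
  exact isClosed_iInter fun v => isClosed_eq (by fun_prop) (by fun_prop)

theorem generator_eq_neg_adjoint [CompleteSpace H] (γ : OneParameterGroup H)
    (hγ : IsStronglyContinuous γ) {D : Submodule ℝ H} (hdense : Dense (D : Set H))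
    (hinv : ∀ t : ℝ, ∀ v ∈ D, γ (Multiplicative.ofAdd t) v ∈ D)
    (hC1 : ∀ v ∈ D, IsC1Vector γ v) :
    generator γ = -(generatorOn γ D hC1).adjoint := by
  have hd : Dense ((generatorOn γ D hC1).domain : Set H) := hdense
  apply LinearPMap.eq_of_eq_graph
  ext ⟨w, u⟩
  rw [mem_graph_generator_iff_inner γ hγ hdense hinv hC1, LinearPMap.mem_graph_iff]
  constructor
  · intro h
    have h' : ∀ v : (generatorOn γ D hC1).domain,
        ⟪-u, (v : H)⟫ = ⟪w, generatorOn γ D hC1 v⟫ := fun v => by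
      rw [inner_neg_left, h v, neg_neg]
    refine ⟨⟨w, LinearPMap.mem_adjoint_domain_of_exists w ⟨-u, h'⟩⟩, rfl, ?_⟩
    rw [LinearPMap.neg_apply, LinearPMap.adjoint_apply_eq hd _ h', neg_neg]
  · rintro ⟨y, rfl, rfl⟩ v
    rw [LinearPMap.neg_apply, inner_neg_left]
    exact congrArg _ (LinearPMap.adjoint_isFormalAdjoint hd y v)

/-- A dense invariant space of `C¹`-vectors is a core of the generator. -/
theorem closure_graph_generatorOn [CompleteSpace H] (γ : OneParameterGroup H)
    (hγ : IsStronglyContinuous γ) {D : Submodule ℝ H} (hdense : Dense (D : Set H))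
    (hinv : ∀ t : ℝ, ∀ v ∈ D, γ (Multiplicative.ofAdd t) v ∈ D)
    (hC1 : ∀ v ∈ D, IsC1Vector γ v) :
    (generatorOn γ D hC1).graph.topologicalClosure = (generator γ).graph := by
  have hle := (generatorOn γ D hC1).graph.topologicalClosure_minimal
    (LinearPMap.le_graph_of_le (generatorOn_le_generator γ hC1))
    (generator_isClosed γ hγ hdense hinv hC1)
  refine le_antisymm hle fun p hp => ?_
  -- The product norm on H × H is the sup norm; orthogonal projection onto the closed graph needs
  -- the equivalent L² norm.
  let e := WithLp.prodContinuousLinearEquiv 2 ℝ H H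
  let K : Submodule ℝ (WithLp 2 (H × H)) :=
    (generatorOn γ D hC1).graph.topologicalClosure.comap e.toLinearMap
  have hK : IsClosed (K : Set (WithLp 2 (H × H))) :=
    (Submodule.isClosed_topologicalClosure _).preimage e.continuous
  have : CompleteSpace K := hK.completeSpace_coe
  obtain ⟨k, hk, q, hq, hkq⟩ := K.exists_add_mem_mem_orthogonal (e.symm p)
  have hp' : p = e k + e q := by rw [← map_add, ← hkq, e.apply_symm_apply]
  have hqB : e q ∈ (generator γ).graph := by
    rw [eq_sub_of_add_eq' hp'.symm]
    exact sub_mem hp (hle hk)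
  -- Orthogonality of q = (x, Bx) to (v, Av) reads ⟪x, v⟫ = -⟪Bx, Av⟫, the weak form of B(Bx) = x.
  have hqB' : (q.snd, q.fst) ∈ (generator γ).graph := by
    rw [mem_graph_generator_iff_inner γ hγ hdense hinv hC1]
    intro v
    have hv : WithLp.toLp 2 ((v : H), generatorOn γ D hC1 v) ∈ K :=
      Submodule.le_topologicalClosure _ ((generatorOn γ D hC1).mem_graph v)
    have := Submodule.inner_left_of_mem_orthogonal hv hq
    rw [WithLp.prod_inner_apply] at this
    exact eq_neg_of_add_eq_zero_left this
  have hq0 : e q = 0 := by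
    obtain ⟨x, hx1, hx2⟩ := (LinearPMap.mem_graph_iff _).1 hqB
    obtain ⟨y, hy1, hy2⟩ := (LinearPMap.mem_graph_iff _).1 hqB'
    have hskew := inner_generator_left γ x y
    rw [hx1, hx2, hy1, hy2] at hskew
    change ⟪q.snd, q.snd⟫ = -⟪q.fst, q.fst⟫ at hskew
    have h1 := real_inner_self_nonneg (x := q.fst)
    have h2 := real_inner_self_nonneg (x := q.snd)
    exact Prod.ext (inner_self_eq_zero.1 (by linarith : ⟪q.fst, q.fst⟫ = 0))
      (inner_self_eq_zero.1 (by linarith : ⟪q.snd, q.snd⟫ = 0))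
  rw [hp', hq0, add_zero]
  exact hk

end RealStone

theorem mainTheorem11 {H : Type*} [NormedAddCommGroup H] [InnerProductSpace ℝ H] [CompleteSpace H]
    (γ : RealStone.OneParameterGroup H) (hγ : RealStone.IsStronglyContinuous γ)
    (D : Submodule ℝ H) (hdense : Dense (D : Set H))
    (hinv : ∀ t : ℝ, ∀ v ∈ D, γ (Multiplicative.ofAdd t) v ∈ D)
    (hC1 : ∀ v ∈ D, RealStone.IsC1Vector γ v) :
    (RealStone.generatorOn γ D hC1).IsClosable ∧
      (RealStone.generatorOn γ D hC1).closure = RealStone.generator γ ∧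
      RealStone.generator γ = -(RealStone.generatorOn γ D hC1).adjoint := by
  have hgraph := RealStone.closure_graph_generatorOn γ hγ hdense hinv hC1
  have hclosable : (RealStone.generatorOn γ D hC1).IsClosable := ⟨_, hgraph⟩
  refine ⟨hclosable, ?_, RealStone.generator_eq_neg_adjoint γ hγ hdense hinv hC1⟩
  exact LinearPMap.eq_of_eq_graph (hclosable.graph_closure_eq_closure_graph.symm.trans hgraph)
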